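/- Let $\zeta$ be the Riemann zeta function and let $$Z=\{\,s\in\mathbb{C}: \Re(s)\ge 0,\ \Im(s)\ge 0,\ \zeta(s)=0\,\}$$ (the non-trivial zeros of $\zeta$ with non-negative imaginary part), partially ordered by the coordinatewise order: $a+ib\le c+id$ if and only if $a\le c$ and $b\le d$ (for $a,b,c,d\in\mathbb{R}$). If $(Z,\le)$ has at least one maximal element, then the Riemann hypothesis is false. -/

import Mathlib

/-- The complex numbers, to be equipped with the coordinatewise order
(Mathlib's own scoped order on `ℂ` is a different one). -/
def CoordComplex : Type := ℂ

namespace CoordComplex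

/-- The underlying complex number. -/
def toComplex (z : CoordComplex) : ℂ := z

/-- A complex number, seen in the coordinatewise ordered copy of `ℂ`. -/
def ofComplex (z : ℂ) : CoordComplex := z

/-- The coordinatewise order: `a + i b ≤ c + i d` if and only if `a ≤ c` and `b ≤ d`. -/
instance instPartialOrder : PartialOrder CoordComplex where
  le z w := z.toComplex.re ≤ w.toComplex.re ∧ z.toComplex.im ≤ w.toComplex.im
  le_refl _ := ⟨le_rfl, le_rfl⟩
  le_trans _ _ _ h k := ⟨h.1.trans k.1, h.2.trans k.2⟩
  le_antisymm _ _ h k := Complex.ext (le_antisymm h.1 k.1) (le_antisymm h.2 k.2)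

theorem le_def (z w : CoordComplex) :
    z ≤ w ↔ z.toComplex.re ≤ w.toComplex.re ∧ z.toComplex.im ≤ w.toComplex.im :=
  Iff.rfl

end CoordComplex

/-- The set `Z = {s : 0 ≤ s, ζ(s) = 0}`, where `≤` is the coordinatewise order. Its elements inherit
the coordinatewise order through the subtype. The pole `s = 1` does not belong to it, since the
value that Mathlib assigns to `riemannZeta 1` is nonzero. -/
def zetaZeroPoset : Set CoordComplex :=
  {s | CoordComplex.ofComplex 0 ≤ s ∧ riemannZeta s.toComplex = 0}

/-!
Riemann's `ξ` has order at most `1` but is not of exponential type, since `ξ(2n + 2)` grows like a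
factorial. An entire function of order at most `1` with finitely many zeros is, by Hadamard's
factorization, `P(s) exp(a s + b)` with `P` a polynomial, hence of exponential type. So `ξ` has
infinitely many zeros, and as these are isolated and lie in the critical strip, their imaginary
parts are unbounded. The symmetry `s ↦ 1 - conj s` of the zeros then provides, above any height, a
zero with real part at least `1 / 2`. It dominates every zero below that height with real part at
most `1 / 2`, so a maximal element must have real part greater than `1 / 2`.
-/

open Complex Filter Metric MeasureTheory Polynomial

theorem differentiable_dslope {E : Type*} [NormedAddCommGroup E] [NormedSpace ℂ E] [CompleteSpace E]
    {f : ℂ → E} (hf : Differentiable ℂ f) (a : ℂ) :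
    Differentiable ℂ (dslope f a) :=
  differentiableOn_univ.1 ((differentiableOn_dslope univ_mem).2 hf.differentiableOn)

theorem exists_eq_pow_mul_of_differentiable {f : ℂ → ℂ} (hf : Differentiable ℂ f) (hf0 : f ≠ 0)
    (a : ℂ) :
    ∃ (n : ℕ) (g : ℂ → ℂ), Differentiable ℂ g ∧ g a ≠ 0 ∧ ∀ z, f z = (z - a) ^ n * g z := by
  obtain ⟨p, hp⟩ := hf.analyticAt a
  have hp0 : p ≠ 0 := by
    rintro rfl
    exact hf0 (AnalyticOnNhd.eq_of_eventuallyEq (fun z _ ↦ hf.analyticAt z)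
      analyticOnNhd_const hp.eventually_eq_zero)
  set g : ℂ → ℂ := (Function.swap dslope a)^[p.order] f
  have hg : Differentiable ℂ g :=
    Function.Iterate.rec (Differentiable ℂ) hf (fun _ h ↦ differentiable_dslope h a) _
  exact ⟨p.order, g, hg, hp.iterate_dslope_fslope_ne_zero hp0, hp.eq_pow_order_mul_iterate_dslope⟩

theorem exists_monic_polynomial_mul_of_finite_zeros {f : ℂ → ℂ} (hf : Differentiable ℂ f)
    (hfin : {z | f z = 0}.Finite) :
    ∃ (P : ℂ[X]) (h : ℂ → ℂ), P.Monic ∧ Differentiable ℂ h ∧ (∀ z, h z ≠ 0) ∧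
      ∀ z, f z = P.eval z * h z := by
  obtain ⟨S, hS⟩ : ∃ S : Finset ℂ, ∀ z, f z = 0 → z ∈ S :=
    ⟨hfin.toFinset, fun z hz ↦ hfin.mem_toFinset.2 hz⟩
  clear hfin
  induction S using Finset.induction_on generalizing f with
  | empty => exact ⟨1, f, monic_one, hf, fun z hz ↦ by simpa using hS z hz, by simp⟩
  | insert a S _ ih =>
    have hf0 : f ≠ 0 := by
      rintro rfl
      exact Set.infinite_univ ((insert a S).finite_toSet.subset fun z _ ↦ hS z rfl)
    obtain ⟨n, g, hg, hga, hfg⟩ := exists_eq_pow_mul_of_differentiable hf hf0 a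
    obtain ⟨P, h, hP, hh, hh0, hgP⟩ := ih hg fun z hz ↦
      (Finset.mem_insert.1 (hS z (by rw [hfg, hz, mul_zero]))).resolve_left
        (by rintro rfl; exact hga hz)
    exact ⟨(X - C a) ^ n * P, h, ((monic_X_sub_C a).pow n).mul hP, hh, hh0, fun z ↦ by
      simp [hfg, hgP, mul_assoc]⟩

theorem eventually_one_le_norm_eval_of_monic {P : ℂ[X]} (hP : P.Monic) :
    ∀ᶠ z in cocompact ℂ, 1 ≤ ‖P.eval z‖ := by
  rcases eq_or_ne P 1 with rfl | h1
  · simp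
  · exact (P.tendsto_norm_atTop (hP.degree_pos.2 h1)
      tendsto_norm_cocompact_atTop).eventually_ge_atTop 1

theorem exists_eq_exp_of_differentiable {h : ℂ → ℂ} (hh : Differentiable ℂ h) (h0 : ∀ z, h z ≠ 0) :
    ∃ g : ℂ → ℂ, Differentiable ℂ g ∧ ∀ z, h z = exp (g z) := by
  obtain ⟨g, hg0, hg⟩ := (hh.deriv.div hh h0).isExactOn_univ.with_val_at 0 (log (h 0))
  have hg' (z : ℂ) : HasDerivAt g (deriv h z / h z) z := hg z (Set.mem_univ z)
  have hquot (z : ℂ) : HasDerivAt (fun z ↦ h z * exp (-g z)) 0 z := by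
    refine ((hh z).hasDerivAt.mul (hg' z).neg.cexp).congr_deriv ?_
    field [h0 z]
  refine ⟨g, fun z ↦ (hg' z).differentiableAt, fun z ↦ ?_⟩
  have hconst : h z * exp (-g z) = h 0 * exp (-g 0) :=
    is_const_of_deriv_eq_zero (fun z ↦ (hquot z).differentiableAt) (fun z ↦ (hquot z).deriv) z 0
  rwa [hg0, exp_neg, exp_neg, exp_log (h0 0), mul_inv_cancel₀ (h0 0),
    mul_inv_eq_one₀ (exp_ne_zero _)] at hconst

theorem iteratedDeriv_eq_zero_of_isLittleO {E : Type*} [NormedAddCommGroup E] [NormedSpace ℂ E]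
    [CompleteSpace E] {g : ℂ → E} (hg : Differentiable ℂ g) {c : ℂ} {B : ℝ → ℝ} {n : ℕ}
    (hgB : ∀ᶠ r in atTop, ∀ z ∈ sphere c r, ‖g z‖ ≤ B r) (hB : B =o[atTop] fun r ↦ r ^ n) :
    iteratedDeriv n g c = 0 := by
  refine norm_le_zero_iff.1 (ge_of_tendsto
    (by simpa using hB.tendsto_div_nhds_zero.const_mul (n.factorial : ℝ)) ?_)
  filter_upwards [hgB, eventually_gt_atTop 0] with r hr hr0
  rw [← mul_div_assoc]
  exact norm_iteratedDeriv_le_of_forall_mem_sphere_norm_le n hr0 hg.diffContOnCl hr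

theorem exists_polynomial_of_iteratedDeriv_eq_zero {g : ℂ → ℂ} (hg : Differentiable ℂ g) {d : ℕ}
    (h : ∀ n, d < n → iteratedDeriv n g 0 = 0) :
    ∃ Q : ℂ[X], Q.natDegree ≤ d ∧ ∀ z, g z = Q.eval z := by
  refine ⟨∑ n ∈ Finset.range (d + 1), C ((n.factorial : ℂ)⁻¹ * iteratedDeriv n g 0) * X ^ n,
    natDegree_sum_le_of_forall_le _ _ fun n hn ↦
      (natDegree_C_mul_X_pow_le _ _).trans (Finset.mem_range_succ_iff.1 hn), fun z ↦ ?_⟩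
  rw [← taylorSeries_eq_of_entire' 0 z hg, tsum_eq_sum (s := Finset.range (d + 1)), eval_finsetSum]
  · simp
  · intro n hn
    simp [h n (by simpa using hn)]

theorem norm_le_of_re_le_on_ball {g : ℂ → ℂ} {M r : ℝ} (hM : 0 < M) (hr : 0 < r)
    (hg : DifferentiableOn ℂ g (ball 0 (2 * r)))
    (hgM : ∀ z ∈ ball (0 : ℂ) (2 * r), (g z).re ≤ M) {z : ℂ} (hz : ‖z‖ = r) :
    ‖g z‖ ≤ 2 * M + 3 * ‖g 0‖ := by
  have hmem : z ∈ ball (0 : ℂ) (2 * r) := by rw [mem_ball_zero_iff]; linarith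
  refine (borelCaratheodory hM hg hgM (by positivity) hmem).trans_eq ?_
  rw [hz]
  field

theorem isLittleO_rpow_rpow_atTop {a b : ℝ} (hab : a < b) :
    (fun x : ℝ ↦ x ^ a) =o[atTop] fun x ↦ x ^ b := by
  refine Asymptotics.isLittleO_of_tendsto' ?_
    ((tendsto_rpow_neg_atTop (sub_pos.2 hab)).congr' ?_)
  · filter_upwards [eventually_gt_atTop 0] with x hx h
    exact absurd h (Real.rpow_pos_of_pos hx b).ne'
  · filter_upwards [eventually_gt_atTop 0] with x hx
    rw [neg_sub, Real.rpow_sub hx]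

theorem exists_polynomial_of_re_le {g : ℂ → ℂ} (hg : Differentiable ℂ g) {A ρ : ℝ} (hρ : 0 ≤ ρ)
    (hA : ∀ z, (g z).re ≤ A * (1 + ‖z‖) ^ ρ) :
    ∃ Q : ℂ[X], Q.natDegree ≤ ⌊ρ⌋₊ ∧ ∀ z, g z = Q.eval z := by
  refine exists_polynomial_of_iteratedDeriv_eq_zero hg fun n hn ↦ ?_
  have hρn : ρ < n := (Nat.floor_lt hρ).1 hn
  refine iteratedDeriv_eq_zero_of_isLittleO hg
    (B := fun r ↦ 2 * ((|A| + 1) * (1 + 2 * r) ^ ρ) + 3 * ‖g 0‖) ?_ ?_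
  · filter_upwards [eventually_gt_atTop 0] with r hr z hz
    refine norm_le_of_re_le_on_ball (by positivity) hr hg.differentiableOn
      (fun w hw ↦ (hA w).trans ?_) (mem_sphere_zero_iff_norm.1 hz)
    have := (mem_ball_zero_iff.1 hw).le
    gcongr
    linarith [le_abs_self A]
  · have hlin : (fun r : ℝ ↦ 1 + 2 * r) =O[atTop] fun r ↦ r :=
      ((Asymptotics.isLittleO_const_id_atTop 1).isBigO).add
        (Asymptotics.isBigO_const_mul_self 2 _ _)
    have hpow : (fun r : ℝ ↦ (1 + 2 * r) ^ ρ) =o[atTop] fun r ↦ r ^ n := by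
      refine (hlin.rpow hρ (eventually_ge_atTop 0)).trans_isLittleO ?_
      simpa only [Real.rpow_natCast] using isLittleO_rpow_rpow_atTop hρn
    have hn0 : n ≠ 0 := by omega
    have hconst : (fun _ : ℝ ↦ 3 * ‖g 0‖) =o[atTop] fun r : ℝ ↦ r ^ n :=
      Asymptotics.isLittleO_const_left.2 (.inr
        (tendsto_norm_atTop_atTop.comp (tendsto_pow_atTop hn0)))
    exact ((hpow.const_mul_left _).const_mul_left _).add hconst

/-- Growth of order at most `ρ` on `S`, of finite type if the order is `ρ`. The base `1 + ‖z‖` makes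
the bound meaningful near the origin and lets `C` absorb constant factors. -/
def HasExpGrowthOn (f : ℂ → ℂ) (ρ : ℝ) (S : Set ℂ) : Prop :=
  ∃ C : ℝ, 0 ≤ C ∧ ∀ z ∈ S, ‖f z‖ ≤ Real.exp (C * (1 + ‖z‖) ^ ρ)

namespace HasExpGrowthOn

variable {f g : ℂ → ℂ} {ρ : ℝ} {S T : Set ℂ}

theorem congr (hf : HasExpGrowthOn f ρ S) (h : Set.EqOn f g S) : HasExpGrowthOn g ρ S := by
  obtain ⟨C, hC0, hC⟩ := hf
  exact ⟨C, hC0, fun z hz ↦ h hz ▸ hC z hz⟩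

theorem mono (hf : HasExpGrowthOn f ρ T) (h : S ⊆ T) : HasExpGrowthOn f ρ S := by
  obtain ⟨C, hC0, hC⟩ := hf
  exact ⟨C, hC0, fun z hz ↦ hC z (h hz)⟩

theorem union (hS : HasExpGrowthOn f ρ S) (hT : HasExpGrowthOn f ρ T) :
    HasExpGrowthOn f ρ (S ∪ T) := by
  obtain ⟨C, hC0, hC⟩ := hS
  obtain ⟨D, hD0, hD⟩ := hT
  refine ⟨C + D, by positivity, fun z hz ↦ ?_⟩
  rcases hz with hz | hz
  · refine (hC z hz).trans ?_
    gcongr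
    linarith
  · refine (hD z hz).trans ?_
    gcongr
    linarith

theorem mul (hf : HasExpGrowthOn f ρ S) (hg : HasExpGrowthOn g ρ S) :
    HasExpGrowthOn (fun z ↦ f z * g z) ρ S := by
  obtain ⟨C, hC0, hC⟩ := hf
  obtain ⟨D, hD0, hD⟩ := hg
  refine ⟨C + D, by positivity, fun z hz ↦ ?_⟩
  rw [norm_mul, add_mul, Real.exp_add]
  exact mul_le_mul (hC z hz) (hD z hz) (norm_nonneg _) (Real.exp_pos _).le

theorem comp {φ : ℂ → ℂ} {K : ℝ} (hρ : 0 ≤ ρ) (hf : HasExpGrowthOn f ρ T) (hφ : Set.MapsTo φ S T)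
    (hK : ∀ z ∈ S, 1 + ‖φ z‖ ≤ K * (1 + ‖z‖)) : HasExpGrowthOn (fun z ↦ f (φ z)) ρ S := by
  obtain ⟨C, hC0, hC⟩ := hf
  refine ⟨C * |K| ^ ρ, by positivity, fun z hz ↦ (hC _ (hφ hz)).trans ?_⟩
  rw [mul_assoc, ← Real.mul_rpow (abs_nonneg K) (by positivity)]
  gcongr
  exact (hK z hz).trans (by gcongr; exact le_abs_self K)

theorem of_norm_le {B : ℝ} (hρ : 0 ≤ ρ) (h : ∀ z ∈ S, ‖f z‖ ≤ B) : HasExpGrowthOn f ρ S := by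
  refine ⟨|B|, abs_nonneg B, fun z hz ↦ (h z hz).trans ?_⟩
  calc B ≤ |B| * 1 := by simpa using le_abs_self B
    _ ≤ |B| * (1 + ‖z‖) ^ ρ := by
        gcongr
        exact Real.one_le_rpow (by simp) hρ
    _ ≤ Real.exp (|B| * (1 + ‖z‖) ^ ρ) := by linarith [Real.add_one_le_exp (|B| * (1 + ‖z‖) ^ ρ)]

theorem add (hρ : 0 ≤ ρ) (hf : HasExpGrowthOn f ρ S) (hg : HasExpGrowthOn g ρ S) :
    HasExpGrowthOn (fun z ↦ f z + g z) ρ S := by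
  obtain ⟨C, hC0, hC⟩ := hf
  obtain ⟨D, hD0, hD⟩ := hg
  refine ⟨C + D + 1, by positivity, fun z hz ↦ ?_⟩
  have hx : 1 ≤ (1 + ‖z‖) ^ ρ := Real.one_le_rpow (by simp) hρ
  set x := (1 + ‖z‖) ^ ρ
  calc ‖f z + g z‖ ≤ Real.exp (C * x) + Real.exp (D * x) := norm_add_le_of_le (hC z hz) (hD z hz)
    _ ≤ Real.exp ((C + D) * x) + Real.exp ((C + D) * x) := by gcongr <;> linarith
    _ ≤ Real.exp ((C + D) * x) * Real.exp x := by
        nlinarith [Real.add_one_le_exp x, Real.exp_pos ((C + D) * x)]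
    _ = Real.exp ((C + D + 1) * x) := by rw [← Real.exp_add]; ring_nf

end HasExpGrowthOn

theorem hasExpGrowthOn_id {ρ : ℝ} (hρ : 1 ≤ ρ) (S : Set ℂ) : HasExpGrowthOn (fun z ↦ z) ρ S := by
  refine ⟨1, zero_le_one, fun z _ ↦ ?_⟩
  calc ‖z‖ ≤ (1 + ‖z‖) ^ (1 : ℝ) := by simp
    _ ≤ (1 + ‖z‖) ^ ρ := Real.rpow_le_rpow_of_exponent_le (by simp) hρ
    _ ≤ Real.exp (1 * (1 + ‖z‖) ^ ρ) := by linarith [Real.add_one_le_exp (1 * (1 + ‖z‖) ^ ρ)]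

theorem hasExpGrowthOn_eval {ρ : ℝ} (hρ : 1 ≤ ρ) (P : ℂ[X]) (S : Set ℂ) :
    HasExpGrowthOn (fun z ↦ P.eval z) ρ S := by
  have hρ0 : 0 ≤ ρ := zero_le_one.trans hρ
  have hC (a : ℂ) : HasExpGrowthOn (fun _ ↦ a) ρ S := .of_norm_le hρ0 fun _ _ ↦ le_rfl
  induction P using Polynomial.induction_on with
  | C a => simpa only [eval_C] using hC a
  | add P Q hP hQ => simpa only [eval_add] using hP.add hρ0 hQ
  | monomial n a h =>
    simpa only [pow_succ, ← mul_assoc, eval_mul, eval_X] using h.mul (hasExpGrowthOn_id hρ S)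

theorem hasExpGrowthOn_exp_eval {Q : ℂ[X]} {n : ℕ} (hQ : Q.natDegree ≤ n) (S : Set ℂ) :
    HasExpGrowthOn (fun z ↦ exp (Q.eval z)) n S := by
  refine ⟨∑ i ∈ Finset.range (n + 1), ‖Q.coeff i‖, by positivity, fun z _ ↦ ?_⟩
  rw [norm_exp, Real.rpow_natCast, Finset.sum_mul]
  gcongr
  refine (re_le_norm _).trans ?_
  rw [eval_eq_sum_range' (Nat.lt_succ_of_le hQ)]
  refine norm_sum_le_of_le _ fun i hi ↦ ?_
  rw [norm_mul, norm_pow]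
  gcongr
  calc ‖z‖ ^ i ≤ (1 + ‖z‖) ^ i := by gcongr; simp
    _ ≤ (1 + ‖z‖) ^ n := pow_le_pow_right₀ (by simp) (Finset.mem_range_succ_iff.1 hi)

theorem exists_eq_polynomial_mul_exp_polynomial {f : ℂ → ℂ} {ρ : ℝ} (hρ : 0 ≤ ρ)
    (hf : Differentiable ℂ f) (hfin : {z | f z = 0}.Finite)
    (hgrowth : HasExpGrowthOn f ρ Set.univ) :
    ∃ P Q : ℂ[X], Q.natDegree ≤ ⌊ρ⌋₊ ∧ ∀ z, f z = P.eval z * exp (Q.eval z) := by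
  obtain ⟨P, h, hP, hh, hh0, hfP⟩ := exists_monic_polynomial_mul_of_finite_zeros hf hfin
  obtain ⟨g, hg, hgh⟩ := exists_eq_exp_of_differentiable hh hh0
  obtain ⟨C, hC0, hC⟩ := hgrowth
  obtain ⟨K, hK, hPK⟩ := mem_cocompact.1 (eventually_one_le_norm_eval_of_monic hP)
  obtain ⟨D, hD⟩ := hK.exists_bound_of_continuousOn hg.continuous.continuousOn
  have hre (z : ℂ) : (g z).re ≤ (C + |D|) * (1 + ‖z‖) ^ ρ := by
    have hx : 1 ≤ (1 + ‖z‖) ^ ρ := Real.one_le_rpow (by simp) hρ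
    by_cases hz : z ∈ K
    · have : (g z).re ≤ D := (re_le_norm _).trans (hD z hz)
      nlinarith [le_abs_self D, abs_nonneg D]
    · have hexp : Real.exp (g z).re ≤ Real.exp (C * (1 + ‖z‖) ^ ρ) :=
        calc Real.exp (g z).re = ‖h z‖ := by rw [hgh, norm_exp]
          _ ≤ ‖P.eval z‖ * ‖h z‖ := le_mul_of_one_le_left (norm_nonneg _) (hPK hz)
          _ = ‖f z‖ := by rw [hfP, norm_mul]
          _ ≤ _ := hC z (Set.mem_univ z)
      have := Real.exp_le_exp.1 hexp
      nlinarith [abs_nonneg D]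
  obtain ⟨Q, hQ, hgQ⟩ := exists_polynomial_of_re_le hg hρ hre
  exact ⟨P, Q, hQ, fun z ↦ by rw [hfP, hgh, hgQ]⟩

theorem HasExpGrowthOn.floor_of_finite_zeros {f : ℂ → ℂ} {ρ : ℝ} (hρ : 1 ≤ ρ)
    (hf : Differentiable ℂ f) (hfin : {z | f z = 0}.Finite)
    (hgrowth : HasExpGrowthOn f ρ Set.univ) : HasExpGrowthOn f ⌊ρ⌋₊ Set.univ := by
  obtain ⟨P, Q, hQ, hfPQ⟩ :=
    exists_eq_polynomial_mul_exp_polynomial (zero_le_one.trans hρ) hf hfin hgrowth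
  have hfloor : (1 : ℝ) ≤ ⌊ρ⌋₊ := mod_cast Nat.le_floor (by simpa using hρ)
  exact ((hasExpGrowthOn_eval hfloor P _).mul (hasExpGrowthOn_exp_eval hQ _)).congr
    fun z _ ↦ (hfPQ z).symm

theorem norm_Gamma_le {s : ℂ} (hs : 0 < s.re) : ‖Gamma s‖ ≤ Real.Gamma s.re := by
  rw [Gamma_eq_integral hs, GammaIntegral, Real.Gamma_eq_integral hs]
  refine (norm_integral_le_integral_norm _).trans_eq
    (setIntegral_congr_fun measurableSet_Ioi fun x hx ↦ ?_)
  simp [norm_cpow_eq_rpow_re_of_pos hx, norm_exp]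

theorem Gamma_le_exp_rpow {x ρ : ℝ} (hx : 2 ≤ x) (hρ : 1 < ρ) :
    Real.Gamma x ≤ Real.exp ((ρ - 1)⁻¹ * (1 + x) ^ ρ) := by
  set n := ⌈x⌉₊
  have hxn : x ≤ n := Nat.le_ceil x
  have hn : (n : ℝ) ≤ 1 + x := by linarith [Nat.ceil_lt_add_one (by linarith : 0 ≤ x)]
  have hn0 : (0 : ℝ) < n := by linarith
  have hε : 0 < ρ - 1 := sub_pos.2 hρ
  have hlog : n * Real.log n ≤ (ρ - 1)⁻¹ * n ^ ρ :=
    calc n * Real.log n ≤ n * (n ^ (ρ - 1) / (ρ - 1)) := by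
          gcongr
          exact Real.log_le_rpow_div hn0.le hε
      _ = (ρ - 1)⁻¹ * n ^ ρ := by
          rw [Real.rpow_sub_one hn0.ne']
          field
  calc Real.Gamma x ≤ Real.Gamma (n + 1) :=
        Real.Gamma_strictMonoOn_Ici.monotoneOn hx (hx.trans (by linarith)) (by linarith)
    _ = n.factorial := Real.Gamma_nat_eq_factorial n
    _ ≤ (n : ℝ) ^ n := mod_cast n.factorial_le_pow
    _ = Real.exp (n * Real.log n) := by rw [Real.exp_nat_mul, Real.exp_log hn0]
    _ ≤ Real.exp ((ρ - 1)⁻¹ * n ^ ρ) := Real.exp_le_exp.2 hlog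
    _ ≤ Real.exp ((ρ - 1)⁻¹ * (1 + x) ^ ρ) := by gcongr

theorem hasExpGrowthOn_Gamma {ρ : ℝ} (hρ : 1 < ρ) : HasExpGrowthOn Gamma ρ {s | 2 ≤ s.re} := by
  have hε : 0 < ρ - 1 := sub_pos.2 hρ
  refine ⟨(ρ - 1)⁻¹, inv_nonneg.2 hε.le, fun s (hs : 2 ≤ s.re) ↦ ?_⟩
  refine (norm_Gamma_le (by linarith)).trans ((Gamma_le_exp_rpow hs hρ).trans ?_)
  gcongr
  exact re_le_norm s

theorem hasExpGrowthOn_Gammaℝ {ρ : ℝ} (hρ : 1 < ρ) : HasExpGrowthOn Gammaℝ ρ {s | 4 ≤ s.re} := by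
  have hρ0 : 0 ≤ ρ := by linarith
  refine HasExpGrowthOn.mul (.of_norm_le (B := 1) hρ0 fun s (hs : 4 ≤ s.re) ↦ ?_)
    ((hasExpGrowthOn_Gamma hρ).comp (K := 1) hρ0 (fun s (hs : 4 ≤ s.re) ↦ ?_) fun s _ ↦ ?_)
  · rw [norm_cpow_eq_rpow_re_of_pos Real.pi_pos, div_ofNat_re, neg_re]
    exact Real.rpow_le_one_of_one_le_of_nonpos (by linarith [Real.pi_gt_three]) (by linarith)
  · simp only [Set.mem_ofPred_eq, div_ofNat_re]
    linarith
  · rw [norm_div, Complex.norm_ofNat]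
    linarith [norm_nonneg s]

theorem norm_riemannZeta_le_tsum {σ : ℝ} (hσ : 1 < σ) {s : ℂ} (hs : σ ≤ s.re) :
    ‖riemannZeta s‖ ≤ ∑' n : ℕ, 1 / (n : ℝ) ^ σ := by
  rw [zeta_eq_tsum_one_div_nat_cpow (hσ.trans_le hs)]
  refine tsum_of_norm_bounded (Real.summable_one_div_nat_rpow.2 hσ).hasSum fun n ↦ ?_
  rcases n.eq_zero_or_pos with rfl | hn
  · simp [zero_cpow (ne_zero_of_one_lt_re (hσ.trans_le hs)), Real.zero_rpow (by linarith : σ ≠ 0)]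
  · rw [norm_div, norm_one, norm_natCast_cpow_of_pos hn]
    gcongr
    exact mod_cast hn

theorem one_le_norm_riemannZeta_natCast {k : ℕ} (hk : 1 < k) : 1 ≤ ‖riemannZeta k‖ := by
  have hreal : riemannZeta k = ((∑' n : ℕ, 1 / (n : ℝ) ^ k : ℝ) : ℂ) := by
    rw [zeta_nat_eq_tsum_of_gt_one hk]
    push_cast
    rfl
  rw [hreal, norm_real]
  refine le_trans ?_ (le_abs_self _)
  simpa using (Real.summable_one_div_nat_pow.2 hk).le_tsum 1 fun n _ ↦ by positivity

theorem exists_norm_mellin_le {E : Type*} [NormedAddCommGroup E] [NormedSpace ℂ E] {f : ℝ → E}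
    {a b : ℝ} (ha : MellinConvergent f a) (hb : MellinConvergent f b) :
    ∃ C : ℝ, ∀ s : ℂ, a ≤ s.re → s.re ≤ b → ‖mellin f s‖ ≤ C := by
  refine ⟨_, fun s has hsb ↦ norm_integral_le_of_norm_le (ha.norm.add hb.norm) ?_⟩
  filter_upwards [ae_restrict_mem measurableSet_Ioi] with t (ht : 0 < t)
  simp only [Pi.add_apply, norm_smul, norm_cpow_eq_rpow_re_of_pos ht, sub_re, ofReal_re, one_re,
    ← add_mul]
  gcongr
  rcases le_total t 1 with h1 | h1
  · exact (Real.rpow_le_rpow_of_exponent_ge ht h1 (by linarith)).trans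
      (le_add_of_nonneg_right (by positivity))
  · exact (Real.rpow_le_rpow_of_exponent_le h1 (by linarith)).trans
      (le_add_of_nonneg_left (by positivity))

theorem exists_norm_completedRiemannZeta₀_le (a b : ℝ) :
    ∃ C : ℝ, ∀ s : ℂ, a ≤ s.re → s.re ≤ b → ‖completedRiemannZeta₀ s‖ ≤ C := by
  set P := HurwitzZeta.hurwitzEvenFEPair 0
  have hconv (s : ℂ) : MellinConvergent P.f_modif s :=
    (P.isStrongFEPair_toStrongFEPair.hasMellin s).1
  obtain ⟨C, hC⟩ := exists_norm_mellin_le (hconv (a / 2 : ℝ)) (hconv (b / 2 : ℝ))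
  refine ⟨C / 2, fun s ha hb ↦ ?_⟩
  have hmellin : completedRiemannZeta₀ s = mellin P.f_modif (s / 2) / 2 := rfl
  rw [hmellin, norm_div, Complex.norm_ofNat]
  gcongr
  apply hC <;> rw [div_ofNat_re] <;> linarith

/-- Riemann's entire function `ξ(s) = s (s - 1) Λ(s) / 2`, whose zeros are the nontrivial zeros of
`ζ`. Writing it with `Λ₀(s) = Λ(s) + 1 / s + 1 / (1 - s)` removes the singularities at `0`, `1`. -/
noncomputable def riemannXi (s : ℂ) : ℂ := (s * (s - 1) * completedRiemannZeta₀ s + 1) / 2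

theorem differentiable_riemannXi : Differentiable ℂ riemannXi := by
  have := differentiable_completedZeta₀
  unfold riemannXi
  fun_prop

theorem riemannXi_one_sub (s : ℂ) : riemannXi (1 - s) = riemannXi s := by
  rw [riemannXi, riemannXi, completedRiemannZeta₀_one_sub]
  ring

theorem riemannXi_eq_mul_riemannZeta {s : ℂ} (h0 : 0 < s.re) (h1 : s ≠ 1) :
    riemannXi s = s * (s - 1) / 2 * Gammaℝ s * riemannZeta s := by
  have hs0 : s ≠ 0 := by
    rintro rfl
    simp at h0
  have hs1 : 1 - s ≠ 0 := sub_ne_zero.2 h1.symm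
  rw [riemannZeta_def_of_ne_zero hs0, mul_assoc, mul_div_cancel₀ _ (Gammaℝ_ne_zero_of_re_pos h0),
    completedRiemannZeta_eq, riemannXi]
  field_simp
  ring

theorem riemannXi_ne_zero_of_one_le_re {s : ℂ} (hs : 1 ≤ s.re) : riemannXi s ≠ 0 := by
  rcases eq_or_ne s 1 with rfl | h1
  · simp [riemannXi]
  · have h0 : 0 < s.re := by linarith
    have hs0 : s ≠ 0 := by
      rintro rfl
      simp at h0
    rw [riemannXi_eq_mul_riemannZeta h0 h1]
    have hpoly : s * (s - 1) / 2 ≠ 0 :=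
      div_ne_zero (mul_ne_zero hs0 (sub_ne_zero.2 h1)) two_ne_zero
    exact mul_ne_zero (mul_ne_zero hpoly (Gammaℝ_ne_zero_of_re_pos h0))
      (riemannZeta_ne_zero_of_one_le_re hs)

theorem re_mem_Ioo_of_riemannXi_eq_zero {s : ℂ} (h : riemannXi s = 0) :
    s.re ∈ Set.Ioo (0 : ℝ) 1 := by
  have hlt {s : ℂ} (h : riemannXi s = 0) : s.re < 1 :=
    not_le.1 fun hs ↦ riemannXi_ne_zero_of_one_le_re hs h
  exact ⟨by simpa using hlt ((riemannXi_one_sub s).trans h), hlt h⟩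

theorem riemannZeta_eq_zero_of_riemannXi_eq_zero {s : ℂ} (h : riemannXi s = 0) :
    riemannZeta s = 0 := by
  obtain ⟨h0, hlt⟩ := re_mem_Ioo_of_riemannXi_eq_zero h
  have h1 : s ≠ 1 := by
    rintro rfl
    simp at hlt
  have hs0 : s ≠ 0 := by
    rintro rfl
    simp at h0
  simpa [riemannXi_eq_mul_riemannZeta h0 h1, hs0, sub_ne_zero.2 h1, Gammaℝ_ne_zero_of_re_pos h0]
    using h

theorem hasExpGrowthOn_riemannXi_of_four_le_re {ρ : ℝ} (hρ : 1 < ρ) :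
    HasExpGrowthOn riemannXi ρ {s | 4 ≤ s.re} := by
  have hprod := ((hasExpGrowthOn_eval hρ.le (X * (X - 1) * C 2⁻¹) _).mul
    (hasExpGrowthOn_Gammaℝ hρ)).mul (.of_norm_le (zero_le_one.trans hρ.le)
      fun s (hs : 4 ≤ s.re) ↦ norm_riemannZeta_le_tsum one_lt_two (by linarith))
  refine hprod.congr fun s (hs : 4 ≤ s.re) ↦ ?_
  have h1 : s ≠ 1 := by
    rintro rfl
    norm_num at hs
  simp [riemannXi_eq_mul_riemannZeta (by linarith) h1, div_eq_mul_inv]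

theorem hasExpGrowthOn_riemannXi_strip {ρ : ℝ} (hρ : 1 ≤ ρ) (a b : ℝ) :
    HasExpGrowthOn riemannXi ρ {s | a ≤ s.re ∧ s.re ≤ b} := by
  have hρ0 : 0 ≤ ρ := zero_le_one.trans hρ
  obtain ⟨B, hB⟩ := exists_norm_completedRiemannZeta₀_le a b
  have hΛ : HasExpGrowthOn completedRiemannZeta₀ ρ {s | a ≤ s.re ∧ s.re ≤ b} :=
    .of_norm_le hρ0 fun s hs ↦ hB s hs.1 hs.2
  refine (((hasExpGrowthOn_eval hρ (X * (X - 1) * C 2⁻¹) _).mul hΛ).add hρ0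
    (hasExpGrowthOn_eval hρ (C 2⁻¹) _)).congr fun s _ ↦ ?_
  simp only [eval_mul, eval_X, eval_sub, eval_one, eval_C, riemannXi]
  ring

theorem hasExpGrowthOn_riemannXi {ρ : ℝ} (hρ : 1 < ρ) : HasExpGrowthOn riemannXi ρ Set.univ := by
  have hright : HasExpGrowthOn riemannXi ρ {s | 0 ≤ s.re} :=
    ((hasExpGrowthOn_riemannXi_strip hρ.le 0 4).union
      (hasExpGrowthOn_riemannXi_of_four_le_re hρ)).mono fun s hs ↦
        (le_total s.re 4).imp (fun h ↦ ⟨hs, h⟩) id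
  have hleft : HasExpGrowthOn riemannXi ρ {s | s.re ≤ 0} := by
    refine (hright.comp (φ := fun s ↦ 1 - s) (K := 2) (by linarith)
      (fun s (hs : s.re ≤ 0) ↦ ?_) fun s _ ↦ ?_).congr fun s _ ↦ riemannXi_one_sub s
    · simp only [Set.mem_ofPred_eq, sub_re, one_re]
      linarith
    · have : ‖1 - s‖ ≤ 1 + ‖s‖ := by simpa using norm_sub_le 1 s
      linarith [norm_nonneg s]
  exact (hright.union hleft).mono fun s _ ↦ le_total 0 s.re

theorem norm_Gammaℝ_two_mul_natCast_add_one (n : ℕ) :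
    ‖Gammaℝ (2 * (n + 1))‖ = n.factorial / Real.pi ^ (n + 1) := by
  have hcast : (-(2 * ((n : ℂ) + 1)) / 2).re = -((n + 1 : ℕ) : ℝ) := by
    rw [neg_div, mul_div_cancel_left₀ _ two_ne_zero, neg_re, ← Nat.cast_add_one, natCast_re]
  rw [Gammaℝ_def, norm_mul, norm_cpow_eq_rpow_re_of_pos Real.pi_pos, hcast,
    Real.rpow_neg Real.pi_pos.le, Real.rpow_natCast, mul_div_cancel_left₀ _ two_ne_zero,
    Gamma_nat_eq_factorial, norm_natCast]
  ring

theorem factorial_div_pi_pow_le_norm_riemannXi (n : ℕ) :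
    n.factorial / Real.pi ^ (n + 1) ≤ ‖riemannXi (2 * (n + 1))‖ := by
  have hre : 0 < (2 * ((n : ℂ) + 1)).re := by
    have : 0 < 2 * ((n : ℝ) + 1) := by positivity
    simpa using this
  have hne : 2 * ((n : ℂ) + 1) ≠ 1 := by norm_cast; omega
  have hpoly : 1 ≤ ‖2 * ((n : ℂ) + 1) * (2 * (n + 1) - 1) / 2‖ := by
    have hnat : 2 * ((n : ℂ) + 1) * (2 * (n + 1) - 1) / 2 = ((n + 1) * (2 * n + 1) : ℕ) := by
      push_cast; ring
    rw [hnat, norm_natCast]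
    exact mod_cast Nat.mul_pos n.succ_pos (2 * n).succ_pos
  have hzeta : 1 ≤ ‖riemannZeta (2 * (n + 1))‖ :=
    mod_cast one_le_norm_riemannZeta_natCast (k := 2 * (n + 1)) (by omega)
  rw [riemannXi_eq_mul_riemannZeta hre hne, norm_mul, norm_mul,
    norm_Gammaℝ_two_mul_natCast_add_one]
  exact (le_mul_of_one_le_left (by positivity) hpoly).trans
    (le_mul_of_one_le_right (by positivity) hzeta)

theorem not_hasExpGrowthOn_riemannXi_one : ¬ HasExpGrowthOn riemannXi 1 Set.univ := by
  rintro ⟨A, -, hA⟩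
  have hle (n : ℕ) : 1 ≤ Real.exp (3 * A) * Real.pi *
      ((Real.exp (2 * A) * Real.pi) ^ n / n.factorial) := by
    have hnorm : ‖2 * ((n : ℂ) + 1)‖ = 2 * (n + 1) := by
      rw [norm_mul, Complex.norm_ofNat, ← Nat.cast_add_one, Complex.norm_natCast, Nat.cast_add_one]
    have h := (factorial_div_pi_pow_le_norm_riemannXi n).trans (hA _ (Set.mem_univ _))
    have hexp : Real.exp (A * (1 + 2 * (n + 1))) = Real.exp (3 * A) * Real.exp (2 * A) ^ n := by
      rw [← Real.exp_nat_mul, ← Real.exp_add]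
      ring_nf
    rw [hnorm, Real.rpow_one, hexp, div_le_iff₀ (by positivity)] at h
    rw [← mul_div_assoc, le_div_iff₀ (by positivity), one_mul]
    exact h.trans_eq (by ring)
  have hlim := (FloorSemiring.tendsto_pow_div_factorial_atTop
    (Real.exp (2 * A) * Real.pi)).const_mul (Real.exp (3 * A) * Real.pi)
  rw [mul_zero] at hlim
  exact one_pos.not_ge (ge_of_tendsto' hlim hle)

theorem infinite_riemannXi_zeros : {s | riemannXi s = 0}.Infinite := by
  intro hfin
  have hfloor : ⌊(3 / 2 : ℝ)⌋₊ = 1 := by norm_num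
  have := HasExpGrowthOn.floor_of_finite_zeros (by norm_num) differentiable_riemannXi hfin
    (hasExpGrowthOn_riemannXi (ρ := 3 / 2) (by norm_num))
  rw [hfloor, Nat.cast_one] at this
  exact not_hasExpGrowthOn_riemannXi_one this

theorem exists_riemannXi_eq_zero_lt_im (T : ℝ) : ∃ s, riemannXi s = 0 ∧ T < s.im := by
  by_contra! h
  refine infinite_riemannXi_zeros (((isCompact_closedBall (0 : ℂ)
    (1 + |T|)).inter_riemannZetaZeros_finite).subset fun s hs ↦
      ⟨?_, riemannZeta_eq_zero_of_riemannXi_eq_zero hs⟩)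
  obtain ⟨h0, h1⟩ := re_mem_Ioo_of_riemannXi_eq_zero hs
  have hupper : s.im ≤ T := h s hs
  have hlower : -s.im ≤ T := by simpa using h (1 - s) ((riemannXi_one_sub s).trans hs)
  have hre : |s.re| ≤ 1 := abs_le.2 ⟨by linarith, h1.le⟩
  have him : |s.im| ≤ |T| := (abs_le'.2 ⟨hupper, hlower⟩).trans (le_abs_self T)
  rw [mem_closedBall_zero_iff]
  exact (norm_le_abs_re_add_abs_im s).trans (add_le_add hre him)

theorem exists_riemannZeta_eq_zero_one_half_le_re_lt_im (T : ℝ) :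
    ∃ s, riemannZeta s = 0 ∧ 1 / 2 ≤ s.re ∧ T < s.im := by
  obtain ⟨s, hs, hT⟩ := exists_riemannXi_eq_zero_lt_im T
  rcases le_total (1 / 2) s.re with hre | hre
  · exact ⟨s, riemannZeta_eq_zero_of_riemannXi_eq_zero hs, hre, hT⟩
  · have hs' : riemannZeta (1 - s) = 0 :=
      riemannZeta_eq_zero_of_riemannXi_eq_zero ((riemannXi_one_sub s).trans hs)
    refine ⟨starRingEnd ℂ (1 - s), by rw [riemannZeta_conj, hs', map_zero], ?_, by simpa using hT⟩
    rw [conj_re, sub_re, one_re]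
    linarith

theorem one_half_lt_re_of_isMax {m : zetaZeroPoset} (hm : IsMax m) :
    1 / 2 < m.1.toComplex.re := by
  by_contra! hle
  obtain ⟨s, hs, hre, him⟩ := exists_riemannZeta_eq_zero_one_half_le_re_lt_im m.1.toComplex.im
  have hms : m.1 ≤ CoordComplex.ofComplex s := ⟨hle.trans hre, him.le⟩
  have hmem : CoordComplex.ofComplex s ∈ zetaZeroPoset := ⟨m.2.1.trans hms, hs⟩
  exact him.not_ge (hm (b := ⟨_, hmem⟩) hms).2

theorem re_eq_one_half_of_riemannHypothesis (hRH : RiemannHypothesis) {s : ℂ}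
    (hs : riemannZeta s = 0) (h0 : 0 ≤ s.re) : s.re = 1 / 2 := by
  refine hRH s hs ?_ ?_
  · rintro ⟨n, rfl⟩
    have hre : (-2 * ((n : ℂ) + 1)).re = -2 * (n + 1) := by simp
    rw [hre] at h0
    linarith [n.cast_nonneg (α := ℝ)]
  · rintro rfl
    exact riemannZeta_one_ne_zero hs

theorem corollary3p2 (h : ∃ m : zetaZeroPoset, IsMax m) : ¬ RiemannHypothesis := by
  intro hRH
  obtain ⟨m, hm⟩ := h
  exact (one_half_lt_re_of_isMax hm).ne' (re_eq_one_half_of_riemannHypothesis hRH m.2.2 m.2.1.1)
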